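/- For $a,b\in\mathbb{C}$ let $\mathcal{W}(a,b)$ be the complex Lie algebra with basis $\{L_m, I_m : m\in\mathbb{Z}\}$ and brackets $$[L_m,L_n]=(m-n)L_{m+n},\qquad [L_m,I_n]=-(n+a+bm)I_{m+n},\qquad [I_m,I_n]=0 .$$ A biderivation of a complex Lie algebra $L$ is a bilinear map $f:L\times L\to L$ with $f([x,y],z)=[x,f(y,z)]+[f(x,z),y]$ and $f(x,[y,z])=[f(x,y),z]+[y,f(x,z)]$ for all $x,y,z\in L$. It is inner if there is $\lambda\in\mathbb{C}$ with $f(x,y)=\lambda[x,y]$ for all $x,y$, and symmetric if $f(x,y)=f(y,x)$ for all $x,y$. Let $\Omega=(\mu_k)_{k\in\mathbb{Z}}$ be a sequence of complex numbers with only finitely many nonzero entries and let $\mu\in\mathbb{C}$. Define bilinear maps, which vanish on all pairs of basis vectors other than the pairs $(L_m,L_n)$, by - $\Psi_\Omega(L_m,L_n)=\sum_{k\in\mathbb{Z}}\mu_k I_{m+n+k}$ on $\mathcal{W}(a,0)$; - $\Upsilon^a_\Omega(L_m,L_n)=\sum_{k\in\mathbb{Z}}(m+n+k+a)\mu_k I_{m+n+k}$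 on $\mathcal{W}(a,1)$; - $\Theta^a_\mu(L_m,L_n)=(m-n)\mu I_{m+n-a}$ on $\mathcal{W}(a,-1)$, for $a\in\mathbb{Z}$. **Theorem.** Let $a,b\in\mathbb{C}$. A bilinear map $f:\mathcal{W}(a,b)\times\mathcal{W}(a,b)\to\mathcal{W}(a,b)$ is a biderivation if and only if it has the following form: - if $b=0$: $f(x,y)=\lambda[x,y]+\Psi_\Omega(x,y)$ for all $x,y$, for some $\lambda\in\mathbb{C}$ and some $\Omega$ as above; - if $b=1$: $f(x,y)=\lambda[x,y]+\Upsilon^a_\Omega(x,y)$ for all $x,y$, for some $\lambda\in\mathbb{C}$ and some $\Omega$ as above; - if $a\in\mathbb{Z}$ and $b=-1$: $f(x,y)=\lambda[x,y]+\Theta^a_\mu(x,y)$ for all $x,y$, for some $\lambda,\mu\in\mathbb{C}$; - in all other cases: $f(x,y)=\lambda[x,y]$ for all $x,y$, for some $\lambda\in\mathbb{C}$. In particular, $\mathcal{W}(a,b)$ has a symmetric non-inner biderivation if and only if $b\in\{0,1\}$. -/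

import Mathlib

/-- A biderivation of a complex Lie algebra: a bilinear map that is a derivation
in each of its two arguments. -/
def IsBiderivation {L : Type*} [LieRing L] [LieAlgebra ℂ L] (f : L →ₗ[ℂ] L →ₗ[ℂ] L) : Prop :=
  (∀ x y z : L, f ⁅x, y⁆ z = ⁅x, f y z⁆ + ⁅f x z, y⁆) ∧
    (∀ x y z : L, f x ⁅y, z⁆ = ⁅f x y, z⁆ + ⁅y, f x z⁆)

/-- A bilinear map is inner if it is a scalar multiple of the Lie bracket. -/
def IsInnerBiderivation {L : Type*} [LieRing L] [LieAlgebra ℂ L] (f : L →ₗ[ℂ] L →ₗ[ℂ] L) :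
    Prop :=
  ∃ c : ℂ, ∀ x y : L, f x y = c • ⁅x, y⁆

/-- The underlying vector space of `𝒲(a,b)`: the complex vector space with basis
`L_m`, `I_m` for `m ∈ ℤ`, where `Sum.inl m` indexes `L_m` and `Sum.inr m` indexes `I_m`. -/
def WAlg (_a _b : ℂ) : Type := (ℤ ⊕ ℤ) →₀ ℂ

namespace WAlg

noncomputable section

instance (a b : ℂ) : AddCommGroup (WAlg a b) := inferInstanceAs (AddCommGroup ((ℤ ⊕ ℤ) →₀ ℂ))

instance (a b : ℂ) : Module ℂ (WAlg a b) := inferInstanceAs (Module ℂ ((ℤ ⊕ ℤ) →₀ ℂ))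

variable {a b : ℂ}

/-- The basis vector `L_m`. -/
def L (m : ℤ) : WAlg a b := Finsupp.single (Sum.inl m) (1 : ℂ)

/-- The basis vector `I_m`. -/
def I (m : ℤ) : WAlg a b := Finsupp.single (Sum.inr m) (1 : ℂ)

/-- The bilinear map with prescribed values on pairs of basis vectors. -/
def bilin (g : ℤ ⊕ ℤ → ℤ ⊕ ℤ → WAlg a b) : WAlg a b →ₗ[ℂ] WAlg a b →ₗ[ℂ] WAlg a b :=
  Finsupp.linearCombination ℂ (fun i => (Finsupp.linearCombination ℂ (g i) :
    ((ℤ ⊕ ℤ) →₀ ℂ) →ₗ[ℂ] WAlg a b))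

/-- The bracket of two basis vectors:
`[L_m, L_n] = (m - n) L_{m+n}`, `[L_m, I_n] = -(n + a + b m) I_{m+n}`, `[I_m, I_n] = 0`. -/
def gen (a b : ℂ) : ℤ ⊕ ℤ → ℤ ⊕ ℤ → WAlg a b
  | Sum.inl m, Sum.inl n => ((m : ℂ) - n) • L (m + n)
  | Sum.inl m, Sum.inr n => (-((n : ℂ) + a + b * m)) • I (m + n)
  | Sum.inr m, Sum.inl n => ((m : ℂ) + a + b * n) • I (m + n)
  | Sum.inr _, Sum.inr _ => 0

instance : Bracket (WAlg a b) (WAlg a b) := ⟨fun x y => bilin (gen a b) x y⟩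

theorem lie_def (x y : WAlg a b) : ⁅x, y⁆ = bilin (gen a b) x y := rfl

theorem induction {p : WAlg a b → Prop} (x : WAlg a b) (h0 : p 0)
    (hadd : ∀ x y, p x → p y → p (x + y)) (hL : ∀ (c : ℂ) m, p (c • L m))
    (hI : ∀ (c : ℂ) m, p (c • I m)) : p x := by
  refine Finsupp.induction_linear (motive := p) x h0 hadd ?_
  rintro (m | m) c
  · have h : (c • L m : WAlg a b) = (Finsupp.single (Sum.inl m) c : (ℤ ⊕ ℤ) →₀ ℂ) :=
      Finsupp.smul_single_one (Sum.inl m) c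
    exact h ▸ hL c m
  · have h : (c • I m : WAlg a b) = (Finsupp.single (Sum.inr m) c : (ℤ ⊕ ℤ) →₀ ℂ) :=
      Finsupp.smul_single_one (Sum.inr m) c
    exact h ▸ hI c m

section bilin
variable (g : ℤ ⊕ ℤ → ℤ ⊕ ℤ → WAlg a b) (m n : ℤ)

theorem bilin_single (i j : ℤ ⊕ ℤ) :
    bilin g (Finsupp.single i (1 : ℂ) : (ℤ ⊕ ℤ) →₀ ℂ) (Finsupp.single j (1 : ℂ) : (ℤ ⊕ ℤ) →₀ ℂ) =
      g i j := by
  have h := Finsupp.linearCombination_single ℂ (v := fun i => (Finsupp.linearCombination ℂ (g i) :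
    ((ℤ ⊕ ℤ) →₀ ℂ) →ₗ[ℂ] WAlg a b)) 1 i
  rw [one_smul] at h
  have h2 := Finsupp.linearCombination_single ℂ (v := g i) 1 j
  rw [one_smul] at h2
  exact (LinearMap.congr_fun h _).trans h2

theorem bilin_L_L : bilin g (L m) (L n) = g (Sum.inl m) (Sum.inl n) := bilin_single g _ _
theorem bilin_L_I : bilin g (L m) (I n) = g (Sum.inl m) (Sum.inr n) := bilin_single g _ _
theorem bilin_I_L : bilin g (I m) (L n) = g (Sum.inr m) (Sum.inl n) := bilin_single g _ _
theorem bilin_I_I : bilin g (I m) (I n) = g (Sum.inr m) (Sum.inr n) := bilin_single g _ _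

end bilin

theorem lie_L_L (m n : ℤ) : ⁅(L m : WAlg a b), (L n : WAlg a b)⁆ = ((m : ℂ) - n) • L (m + n) :=
  bilin_L_L _ m n
theorem lie_L_I (m n : ℤ) :
    ⁅(L m : WAlg a b), (I n : WAlg a b)⁆ = (-((n : ℂ) + a + b * m)) • I (m + n) :=
  bilin_L_I _ m n
theorem lie_I_L (m n : ℤ) :
    ⁅(I m : WAlg a b), (L n : WAlg a b)⁆ = ((m : ℂ) + a + b * n) • I (m + n) :=
  bilin_I_L _ m n
theorem lie_I_I (m n : ℤ) : ⁅(I m : WAlg a b), (I n : WAlg a b)⁆ = 0 :=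
  bilin_I_I _ m n

theorem lie_skew_aux (x y : WAlg a b) :
    bilin (gen a b) x y = -bilin (gen a b) y x := by
  induction x using WAlg.induction with
  | h0 => simp
  | hadd x x' h h' => simp only [map_add, LinearMap.add_apply, h, h']; abel
  | hL c m =>
    induction y using WAlg.induction with
    | h0 => simp
    | hadd x x' h h' => simp only [map_add, LinearMap.add_apply, h, h']; abel
    | hL d n =>
      simp only [map_smul, LinearMap.smul_apply, bilin_L_L, gen, add_comm n m]
      module
    | hI d n =>
      simp only [map_smul, LinearMap.smul_apply, bilin_L_I, bilin_I_L, gen, add_comm n m]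
      module
  | hI c m =>
    induction y using WAlg.induction with
    | h0 => simp
    | hadd x x' h h' => simp only [map_add, LinearMap.add_apply, h, h']; abel
    | hL d n =>
      simp only [map_smul, LinearMap.smul_apply, bilin_L_I, bilin_I_L, gen, add_comm n m]
      module
    | hI d n =>
      simp only [map_smul, LinearMap.smul_apply, bilin_I_I, gen, smul_zero, neg_zero]

theorem jacobi_aux (x y z : WAlg a b) :
    bilin (gen a b) x (bilin (gen a b) y z) =
      bilin (gen a b) (bilin (gen a b) x y) z + bilin (gen a b) y (bilin (gen a b) x z) := by
  induction x using WAlg.induction with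
  | h0 => simp
  | hadd x x' h h' => simp only [map_add, LinearMap.add_apply, h, h']; abel
  | hL c m =>
    induction y using WAlg.induction with
    | h0 => simp
    | hadd x x' h h' => simp only [map_add, LinearMap.add_apply, h, h']; abel
    | hL d n =>
      induction z using WAlg.induction with
      | h0 => simp
      | hadd x x' h h' => simp only [map_add, h, h']; abel
      | hL e k =>
        simp only [map_smul, LinearMap.smul_apply, bilin_L_L, gen,
          show n + (m + k) = m + (n + k) by ring, show m + n + k = m + (n + k) by ring]
        push_cast
        module
      | hI e k =>
        simp only [map_smul, LinearMap.smul_apply, bilin_L_L, bilin_L_I, gen,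
          show n + (m + k) = m + (n + k) by ring, show m + n + k = m + (n + k) by ring]
        push_cast
        module
    | hI d n =>
      induction z using WAlg.induction with
      | h0 => simp
      | hadd x x' h h' => simp only [map_add, h, h']; abel
      | hL e k =>
        simp only [map_smul, LinearMap.smul_apply, bilin_L_L, bilin_L_I, bilin_I_L, gen,
          show n + (m + k) = m + (n + k) by ring, show m + n + k = m + (n + k) by ring]
        push_cast
        module
      | hI e k =>
        simp [bilin_L_I, bilin_I_I, gen]
  | hI c m =>
    induction y using WAlg.induction with
    | h0 => simp
    | hadd x x' h h' => simp only [map_add, LinearMap.add_apply, h, h']; abel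
    | hL d n =>
      induction z using WAlg.induction with
      | h0 => simp
      | hadd x x' h h' => simp only [map_add, h, h']; abel
      | hL e k =>
        simp only [map_smul, LinearMap.smul_apply, bilin_L_L, bilin_L_I, bilin_I_L, gen,
          show n + (m + k) = m + (n + k) by ring, show m + n + k = m + (n + k) by ring]
        push_cast
        module
      | hI e k =>
        simp [bilin_L_I, bilin_I_L, bilin_I_I, gen]
    | hI d n =>
      induction z using WAlg.induction with
      | h0 => simp
      | hadd x x' h h' => simp only [map_add, h, h']; abel
      | hL e k =>
        simp [bilin_I_L, bilin_I_I, gen]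
      | hI e k =>
        simp [bilin_I_I, gen]

instance : LieRing (WAlg a b) where
  add_lie x y z := by simp only [lie_def, map_add, LinearMap.add_apply]
  lie_add x y z := by simp only [lie_def, map_add]
  lie_self x := by
    have h := lie_skew_aux x x
    rw [lie_def]
    have h2 : (2 : ℂ) • bilin (gen a b) x x = 0 := by
      rw [two_smul]; nth_rewrite 1 [h]; simp
    exact (smul_eq_zero.mp h2).resolve_left two_ne_zero
  leibniz_lie x y z := jacobi_aux x y z

instance : LieAlgebra ℂ (WAlg a b) where
  lie_smul c x y := by simp only [lie_def, map_smul]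

/-- The map `Ψ_Ω` on `𝒲(a,0)`: `Ψ_Ω(L_m, L_n) = ∑ k, μ_k I_{m+n+k}`, and `Ψ_Ω` vanishes on all
other pairs of basis vectors; here `Ω = (μ_k)` has only finitely many nonzero entries. -/
def Psi (a : ℂ) (Ω : ℤ →₀ ℂ) : WAlg a 0 →ₗ[ℂ] WAlg a 0 →ₗ[ℂ] WAlg a 0 :=
  bilin fun
    | Sum.inl m, Sum.inl n => Ω.sum fun k μ => μ • I (m + n + k)
    | _, _ => 0

/-- The map `Υ^a_Ω` on `𝒲(a,1)`:
`Υ^a_Ω(L_m, L_n) = ∑ k, (m + n + k + a) μ_k I_{m+n+k}`, and `Υ^a_Ω` vanishes on all other pairs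
of basis vectors. -/
def Upsilon (a : ℂ) (Ω : ℤ →₀ ℂ) : WAlg a 1 →ₗ[ℂ] WAlg a 1 →ₗ[ℂ] WAlg a 1 :=
  bilin fun
    | Sum.inl m, Sum.inl n => Ω.sum fun k μ => (((m : ℂ) + n + k + a) * μ) • I (m + n + k)
    | _, _ => 0

/-- The map `Θ^a_μ` on `𝒲(a,-1)` for an integer `a`:
`Θ^a_μ(L_m, L_n) = (m - n) μ I_{m+n-a}`, and `Θ^a_μ` vanishes on all other pairs of basis
vectors. -/
def Theta (a : ℤ) (μ : ℂ) :
    WAlg (a : ℂ) (-1) →ₗ[ℂ] WAlg (a : ℂ) (-1) →ₗ[ℂ] WAlg (a : ℂ) (-1) :=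
  bilin fun
    | Sum.inl m, Sum.inl n => (((m : ℂ) - n) * μ) • I (m + n - a)
    | _, _ => 0

end

end WAlg

/-! The `I_k` span an abelian ideal with quotient the Witt algebra, and bracketing with `L_m` acts
separately on the `I`-coordinates (with parameter `b`) and on the `L`-coordinates (the same formula
with `b = -1`, `a = 0`). Collecting the coordinates of `f (L m) (L n)` at index `m + n + k`, for
fixed `k`, turns the biderivation identities into the scalar recursions `BiderCoeff b s`, with `s =
k + a` for `I` and `s = k` for `L`.

Setting an index to 0 ties `B m p` to `B 0 p` and to `B m 0`. Compatibility of the two leaves only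
constants for `b = 0`, multiples of `m + p + s` for `b = 1`, multiples of `m - p` for `b = -1`, `s =
0`, and nothing otherwise.

Hence the `L`-part of `f` on pairs `(L_m, L_n)` is a multiple of the bracket, which is subtracted.
On pairs containing some `I_n`, the diagonal action of `L_0` leaves at most one possible place for a
nonzero coordinate, and a further identity kills it (`exists_eq_lie_add`). The remaining
coefficients are read off the list above; conversely each solution defines a biderivation
(`isBiderivation_homogeneous`). Since `Psi` and `Upsilon` are symmetric while the bracket and
`Theta` are skew, the last claim follows. -/

/-- The identities satisfied by the coefficients of a homogeneous biderivation of the Witt algebra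
with values in the module with action `L_m v_n = -(n + b m) v_{m+n}`, where `B m n` is the
coefficient of `v_{m+n+s}` in the value at `(L_m, L_n)`. -/
structure BiderCoeff (b s : ℂ) (B : ℤ → ℤ → ℂ) : Prop where
  left : ∀ m n p : ℤ, ((m : ℂ) - n) * B (m + n) p =
    -((n : ℂ) + p + s + b * m) * B n p + ((m : ℂ) + p + s + b * n) * B m p
  right : ∀ m n p : ℤ, ((m : ℂ) - n) * B p (m + n) =
    -((n : ℂ) + p + s + b * m) * B p n + ((m : ℂ) + p + s + b * n) * B p m

theorem exists_add_eq_of_ne (q : ℤ) : ∃ m n : ℤ, m + n = q ∧ m ≠ q ∧ n ≠ q ∧ m ≠ n := by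
  -- The splitting `(q + 1) + (-1)` fails only when `-1 = q` or when its two parts coincide.
  by_cases h : q = -1 ∨ q = -2
  · exact ⟨q + 3, -3, by lia, by lia, by lia, by lia⟩
  · exact ⟨q + 1, -1, by lia, by lia, by lia, by lia⟩

/-- A function on `ℤ` supported at one point vanishes if `(m - n) g (m + n)` is always a combination
of `g m` and `g n`. -/
theorem eq_zero_of_support_singleton {g : ℤ → ℂ} {α β : ℤ → ℤ → ℂ}
    (h : ∀ m n : ℤ, ((m : ℂ) - n) * g (m + n) = α m n * g n + β m n * g m)
    {q : ℤ} (hq : ∀ m, m ≠ q → g m = 0) (m : ℤ) : g m = 0 := by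
  by_cases hm : m = q
  · obtain ⟨i, j, hij, hi, hj, hne⟩ := exists_add_eq_of_ne q
    have h1 := h i j
    rw [hij, hq i hi, hq j hj, mul_zero, mul_zero, add_zero] at h1
    rw [hm]
    exact (mul_eq_zero.mp h1).resolve_left (sub_ne_zero.mpr (by exact_mod_cast hne))
  · exact hq m hm

/-! ### Solving the coefficient recursions -/

namespace BiderCoeff

variable {b s : ℂ} {B C : ℤ → ℤ → ℂ}

theorem sub (hB : BiderCoeff b s B) (hC : BiderCoeff b s C) :
    BiderCoeff b s (fun m n => B m n - C m n) where
  left m n p := by linear_combination hB.left m n p - hC.left m n p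
  right m n p := by linear_combination hB.right m n p - hC.right m n p

theorem const (s c : ℂ) : BiderCoeff 0 s (fun _ _ => c) where
  left m n p := by ring
  right m n p := by ring

theorem add_mul_const (s c : ℂ) : BiderCoeff 1 s (fun m n => ((m : ℂ) + n + s) * c) where
  left m n p := by push_cast; ring
  right m n p := by push_cast; ring

theorem sub_mul_const (c : ℂ) : BiderCoeff (-1) 0 (fun m n => ((m : ℂ) - n) * c) where
  left m n p := by push_cast; ring
  right m n p := by push_cast; ring

theorem left_zero (hB : BiderCoeff b s B) (m p : ℤ) :
    ((p : ℂ) + s) * B m p = ((p : ℂ) + s + b * m) * B 0 p := by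
  have h := hB.left m 0 p
  rw [add_zero] at h
  push_cast at h
  linear_combination -h

theorem right_zero (hB : BiderCoeff b s B) (m p : ℤ) :
    ((m : ℂ) + s) * B m p = ((m : ℂ) + s + b * p) * B m 0 := by
  have h := hB.right p 0 m
  rw [add_zero] at h
  push_cast at h
  linear_combination -h

/-- The two relations become `(p + s) * B m p = 0` and `(m + s) * B m p = 0`, so only `m = p = -s`
could survive, and a single point cannot. -/
theorem eq_zero_of_axes (hB : BiderCoeff b s B) (h0 : ∀ p, B 0 p = 0) (h0' : ∀ m, B m 0 = 0)
    (m p : ℤ) : B m p = 0 := by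
  have hl := hB.left_zero m p
  rw [h0, mul_zero] at hl
  rcases mul_eq_zero.mp hl with hp | hp
  · refine eq_zero_of_support_singleton (g := fun i => B i p) (fun i j => hB.left i j p)
      (q := p) (fun i hi => ?_) m
    have hr := hB.right_zero i p
    rw [h0', mul_zero] at hr
    refine (mul_eq_zero.mp hr).resolve_left fun hi' => hi ?_
    have : (i : ℂ) = p := by linear_combination hi' - hp
    exact_mod_cast this
  · exact hp

theorem eq_zero_of_ne_zero (hB : BiderCoeff b s B) (hs : s ≠ 0) (h00 : B 0 0 = 0)
    (m p : ℤ) : B m p = 0 := by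
  refine hB.eq_zero_of_axes (fun p => ?_) (fun m => ?_) m p
  · have h := hB.right_zero 0 p
    simpa [h00, hs] using h
  · have h := hB.left_zero m 0
    simpa [h00, hs] using h

theorem eq_of_b_zero (hB : BiderCoeff 0 s B) (m p : ℤ) : B m p = B 0 0 := by
  by_cases hs : s = 0
  · subst hs
    have h1 : ∀ m p : ℤ, p ≠ 0 → B m p = B 0 p := fun m p hp => by
      have h := hB.left_zero m p
      simpa [hp] using h
    have h2 : ∀ m p : ℤ, m ≠ 0 → B m p = B m 0 := fun m p hm => by
      have h := hB.right_zero m p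
      simpa [hm] using h
    have h3 : ∀ p, p ≠ 0 → B 0 p = B 1 0 := fun p hp => by
      rw [← h1 1 p hp, h2 1 p one_ne_zero]
    have h4 : ∀ m p : ℤ, m ≠ 0 → B m p = B 1 0 := fun m p hm => by
      rw [h2 m p hm, ← h2 m 1 hm, h1 m 1 one_ne_zero, h3 1 one_ne_zero]
    -- For fixed `p`, the difference from the constant is supported at `m = 0`.
    have h5 : ∀ m p : ℤ, B m p = B 1 0 := fun m p => sub_eq_zero.mp <|
      eq_zero_of_support_singleton (fun i j => (hB.sub (const 0 (B 1 0))).left i j p) (q := 0)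
        (fun i hi => sub_eq_zero.mpr (h4 i p hi)) m
    rw [h5, h5 0 0]
  · have h := (hB.sub (const s (B 0 0))).eq_zero_of_ne_zero hs (sub_self _) m p
    exact sub_eq_zero.mp h

theorem zero_zero_eq_zero (hB : BiderCoeff b 0 B) (hb : b ≠ 0) : B 0 0 = 0 := by
  have h := hB.right_zero 0 1
  simpa [hb] using h

/-- Eliminates `B m p` between `left_zero` and `right_zero`. Both sides acquire the common factor `m
+ p` when `b = 1`, and `p - m` up to sign when `b = -1`. -/
theorem axes_symm (hB : BiderCoeff b 0 B) (m p : ℤ) :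
    (m : ℂ) * (p + b * m) * B 0 p = p * (m + b * p) * B m 0 := by
  linear_combination -(m : ℂ) * hB.left_zero m p + (p : ℂ) * hB.right_zero m p

/-- The increment `B 0 1 - B 0 0` recovers the constant whether or not `s = 0`. -/
theorem eq_of_b_one (hB : BiderCoeff 1 s B) (m p : ℤ) :
    B m p = ((m : ℂ) + p + s) * (B 0 1 - B 0 0) := by
  suffices h : ∃ c, ∀ m p : ℤ, B m p = ((m : ℂ) + p + s) * c by
    obtain ⟨c, hc⟩ := h
    rw [hc m p, hc 0 1, hc 0 0]
    push_cast
    ring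
  by_cases hs : s = 0
  · subst hs
    have h00 := hB.zero_zero_eq_zero one_ne_zero
    have key : ∀ m p : ℤ, m + p ≠ 0 → (m : ℂ) * B 0 p = p * B m 0 := fun m p h => by
      have h' : (m : ℂ) + p ≠ 0 := by exact_mod_cast h
      refine mul_left_cancel₀ h' ?_
      linear_combination hB.axes_symm m p
    have h1 : B 1 0 = B 0 1 := by simpa using (key 1 1 (by decide)).symm
    have hm : ∀ m : ℤ, m ≠ -1 → B m 0 = m * B 0 1 := fun m h => by
      simpa using (key m 1 (by lia)).symm
    have hp : ∀ p : ℤ, p ≠ -1 → B 0 p = p * B 0 1 := fun p h => by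
      simpa [h1] using key 1 p (by lia)
    -- The pair `(-1, 1)` is excluded from `key`, so the missing values come from pairs with 2.
    have hm' : B (-1) 0 = -B 0 1 := by
      have h := key (-1) 2 (by decide)
      rw [hp 2 (by decide)] at h
      push_cast at h
      linear_combination -h / 2
    have hp' : B 0 (-1) = -B 0 1 := by
      have h := key 2 (-1) (by decide)
      rw [hm 2 (by decide)] at h
      push_cast at h
      linear_combination h / 2
    refine ⟨B 0 1, fun m p => sub_eq_zero.mp ?_⟩
    refine (hB.sub (add_mul_const 0 (B 0 1))).eq_zero_of_axes (fun p => ?_) (fun m => ?_) m p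
    · by_cases h : p = -1
      · rw [h, hp']; push_cast; ring
      · rw [hp p h]; push_cast; ring
    · by_cases h : m = -1
      · rw [h, hm']; push_cast; ring
      · rw [hm m h]; push_cast; ring
  · refine ⟨B 0 0 / s, fun m p => sub_eq_zero.mp ?_⟩
    refine (hB.sub (add_mul_const s (B 0 0 / s))).eq_zero_of_ne_zero hs ?_ m p
    push_cast
    field_simp
    ring

theorem eq_of_b_neg_one (hB : BiderCoeff (-1) 0 B) (m p : ℤ) :
    B m p = ((m : ℂ) - p) * B 1 0 := by
  have key : ∀ m p : ℤ, m ≠ p → (m : ℂ) * B 0 p = -p * B m 0 := fun m p h => by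
    have h' : (p : ℂ) - m ≠ 0 := sub_ne_zero.mpr (by exact_mod_cast h.symm)
    refine mul_left_cancel₀ h' ?_
    linear_combination hB.axes_symm m p
  have hp : ∀ p : ℤ, p ≠ 1 → B 0 p = -p * B 1 0 := fun p h => by
    simpa using key 1 p h.symm
  have hm : ∀ m : ℤ, B m 0 = m * B 1 0 := fun m => by
    by_cases h : m = -1
    · have h1 := key (-1) 2 (by decide)
      rw [hp 2 (by decide)] at h1
      rw [h]
      push_cast at h1 ⊢
      linear_combination h1 / 2
    · have h1 := key m (-1) h
      rw [hp (-1) (by decide)] at h1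
      push_cast at h1
      linear_combination -h1
  refine sub_eq_zero.mp ?_
  refine (hB.sub (sub_mul_const (B 1 0))).eq_zero_of_axes (fun p => ?_) (fun m => ?_) m p
  · by_cases h : p = 1
    · have h1 := key 2 1 (by decide)
      rw [hm 2] at h1
      rw [h]
      push_cast at h1 ⊢
      linear_combination h1 / 2
    · rw [hp p h]; push_cast; ring
  · rw [hm]; push_cast; ring

theorem eq_zero (hB : BiderCoeff b s B) (h0 : b ≠ 0) (h1 : b ≠ 1) (hs : b = -1 → s ≠ 0)
    (m p : ℤ) : B m p = 0 := by
  by_cases h : s = 0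
  · subst h
    have hb : 1 + b ≠ 0 := fun h => hs (by linear_combination h) rfl
    have hb1 : b - 1 ≠ 0 := sub_ne_zero.mpr h1
    have h00 := hB.zero_zero_eq_zero h0
    -- The relation at `(p, p)` makes the axes agree as `b ≠ -1`, and at `(-p, p)` makes them even
    -- as `b ≠ 1`. Then `(2p, p)` and `(-2p, p)` give both `B (2p) 0 = B p 0` and `B (2p) 0 = 4 B p
    -- 0`.
    have hsymm : ∀ p : ℤ, B 0 p = B p 0 := fun p => by
      by_cases hp : p = 0
      · rw [hp]
      · have h' : (p : ℂ) * p * (1 + b) ≠ 0 := by simp [hp, hb]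
        refine mul_left_cancel₀ h' ?_
        linear_combination hB.axes_symm p p
    have heven : ∀ p : ℤ, B (-p) 0 = B p 0 := fun p => by
      by_cases hp : p = 0
      · rw [hp, neg_zero]
      · have h' : (p : ℂ) * p * (b - 1) ≠ 0 := by simp [hp, hb1]
        have h2 := hB.axes_symm (-p) p
        rw [hsymm] at h2
        refine mul_left_cancel₀ h' ?_
        push_cast at h2
        linear_combination -h2
    have hz : ∀ p : ℤ, B p 0 = 0 := fun p => by
      by_cases hp : p = 0
      · rw [hp, h00]
      · have e1 := hB.axes_symm (2 * p) p
        have e2 := hB.axes_symm (-(2 * p)) p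
        rw [hsymm] at e1 e2
        rw [heven] at e2
        push_cast at e1 e2
        have h' : (p : ℂ) * p * b ≠ 0 := by simp [hp, h0]
        have e3 : (p : ℂ) * p * B p 0 = p * p * B (2 * p) 0 := by
          linear_combination (e1 - e2) / 4
        have e4 : (p : ℂ) * p * b * (4 * B p 0 - B (2 * p) 0) = 0 := by
          linear_combination (e1 + e2) / 2
        have e5 := (mul_eq_zero.mp e4).resolve_left h'
        have h'' : (p : ℂ) * p ≠ 0 := by simp [hp]
        have e6 := mul_left_cancel₀ h'' e3
        linear_combination (e5 - e6) / 3
    exact hB.eq_zero_of_axes (fun p => by rw [hsymm, hz]) hz m p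
  · refine hB.eq_zero_of_ne_zero h ?_ m p
    -- Two routes lead from `B 0 0` to `B m p`, through `B 0 p` and through `B m 0`. After
    -- cross-multiplication their discrepancy has a coefficient free of `s`, nonzero at `(2, 1)`.
    have e : ∀ m p : ℤ, (m : ℂ) * p * (m - p) * (b * (b - 1)) * B 0 0 = 0 := fun m p => by
      have l1 := hB.left_zero m p
      have r1 := hB.right_zero m p
      have l0 := hB.left_zero m 0
      have r0 := hB.right_zero 0 p
      push_cast at l0 r0
      linear_combination -s * (m + s) * l1 + s * (p + s) * r1 + (p + s) * (m + s + b * p) * l0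
        - (m + s) * (p + s + b * m) * r0
    have e' := e 2 1
    push_cast at e'
    have h2 : (2 : ℂ) * 1 * (2 - 1) * (b * (b - 1)) ≠ 0 := by
      norm_num [h0, sub_ne_zero.mpr h1]
    exact (mul_eq_zero.mp e').resolve_left h2

end BiderCoeff

/-! ### Coordinates of brackets with basis vectors -/

namespace WAlg

variable {a b : ℂ}

/-- The coordinate at `L_k`. -/
noncomputable def coordL (k : ℤ) : WAlg a b →ₗ[ℂ] ℂ :=
  (Finsupp.lapply (Sum.inl k) : ((ℤ ⊕ ℤ) →₀ ℂ) →ₗ[ℂ] ℂ)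

/-- The coordinate at `I_k`. -/
noncomputable def coordI (k : ℤ) : WAlg a b →ₗ[ℂ] ℂ :=
  (Finsupp.lapply (Sum.inr k) : ((ℤ ⊕ ℤ) →₀ ℂ) →ₗ[ℂ] ℂ)

theorem ext_coord {x y : WAlg a b} (hL : ∀ k, coordL k x = coordL k y)
    (hI : ∀ k, coordI k x = coordI k y) : x = y := by
  refine Finsupp.ext (f := (x : (ℤ ⊕ ℤ) →₀ ℂ)) (g := (y : (ℤ ⊕ ℤ) →₀ ℂ)) ?_
  rintro (k | k)
  exacts [hL k, hI k]

theorem coordL_L (k m : ℤ) : coordL k (L m : WAlg a b) = if m = k then 1 else 0 := by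
  refine (Finsupp.single_apply (a := (Sum.inl m : ℤ ⊕ ℤ)) (a' := Sum.inl k)).trans ?_
  simp only [Sum.inl.injEq]

theorem coordI_I (k m : ℤ) : coordI k (I m : WAlg a b) = if m = k then 1 else 0 := by
  refine (Finsupp.single_apply (a := (Sum.inr m : ℤ ⊕ ℤ)) (a' := Sum.inr k)).trans ?_
  simp only [Sum.inr.injEq]

theorem coordL_I (k m : ℤ) : coordL k (I m : WAlg a b) = 0 := by
  refine (Finsupp.single_apply (a := (Sum.inr m : ℤ ⊕ ℤ)) (a' := Sum.inl k)).trans ?_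
  simp

theorem coordI_L (k m : ℤ) : coordI k (L m : WAlg a b) = 0 := by
  refine (Finsupp.single_apply (a := (Sum.inl m : ℤ ⊕ ℤ)) (a' := Sum.inr k)).trans ?_
  simp

theorem coordL_lie_L (m k : ℤ) (x : WAlg a b) :
    coordL (m + k) ⁅(L m : WAlg a b), x⁆ = ((m : ℂ) - k) * coordL k x := by
  induction x using WAlg.induction with
  | h0 => simp
  | hadd x y hx hy => rw [lie_add, map_add, hx, hy, map_add, mul_add]
  | hL c n =>
    by_cases h : n = k
    · simp [lie_L_L, coordL_L, h, mul_comm]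
    · simp [lie_L_L, coordL_L, h]
  | hI c n => simp [lie_L_I, coordL_I]

theorem coordI_lie_L (m k : ℤ) (x : WAlg a b) :
    coordI (m + k) ⁅(L m : WAlg a b), x⁆ = -((k : ℂ) + a + b * m) * coordI k x := by
  induction x using WAlg.induction with
  | h0 => simp
  | hadd x y hx hy => rw [lie_add, map_add, hx, hy, map_add, mul_add]
  | hL c n => simp [lie_L_L, coordI_L]
  | hI c n =>
    by_cases h : n = k
    · simp [lie_L_I, coordI_I, h, mul_comm]
    · simp [lie_L_I, coordI_I, h]

theorem coordL_lie_I (m k : ℤ) (x : WAlg a b) : coordL k ⁅(I m : WAlg a b), x⁆ = 0 := by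
  induction x using WAlg.induction with
  | h0 => simp
  | hadd x y hx hy => rw [lie_add, map_add, hx, hy, add_zero]
  | hL c n => simp [lie_I_L, coordL_I]
  | hI c n => simp [lie_I_I]

theorem coordI_lie_I (m k : ℤ) (x : WAlg a b) :
    coordI (m + k) ⁅(I m : WAlg a b), x⁆ = ((m : ℂ) + a + b * k) * coordL k x := by
  induction x using WAlg.induction with
  | h0 => simp
  | hadd x y hx hy => rw [lie_add, map_add, hx, hy, map_add, mul_add]
  | hL c n =>
    by_cases h : n = k
    · simp [lie_I_L, coordI_I, coordL_L, h, mul_comm]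
    · simp [lie_I_L, coordI_I, coordL_L, h]
  | hI c n => simp [lie_I_I, coordL_I]

theorem hom_ext {f g : WAlg a b →ₗ[ℂ] WAlg a b →ₗ[ℂ] WAlg a b}
    (hLL : ∀ m n, f (L m) (L n) = g (L m) (L n)) (hLI : ∀ m n, f (L m) (I n) = g (L m) (I n))
    (hIL : ∀ m n, f (I m) (L n) = g (I m) (L n)) (hII : ∀ m n, f (I m) (I n) = g (I m) (I n)) :
    f = g := by
  refine LinearMap.ext₂ fun x y => ?_
  induction x using WAlg.induction with
  | h0 => simp
  | hadd x x' h h' => simp only [map_add, LinearMap.add_apply, h, h']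
  | hL c m =>
    induction y using WAlg.induction with
    | h0 => simp
    | hadd y y' h h' => simp only [map_add, h, h']
    | hL d n => simp only [map_smul, LinearMap.smul_apply, hLL]
    | hI d n => simp only [map_smul, LinearMap.smul_apply, hLI]
  | hI c m =>
    induction y using WAlg.induction with
    | h0 => simp
    | hadd y y' h h' => simp only [map_add, h, h']
    | hL d n => simp only [map_smul, LinearMap.smul_apply, hIL]
    | hI d n => simp only [map_smul, LinearMap.smul_apply, hII]

end WAlg

/-- A bilinear map takes pairs `(L_m, L_n)` into the span of the `I_k` and vanishes on the other
pairs of basis vectors. -/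
structure WAlg.ConcentratedLL {a b : ℂ} (g : WAlg a b →ₗ[ℂ] WAlg a b →ₗ[ℂ] WAlg a b) : Prop where
  coordL_L_L : ∀ m n k, coordL k (g (L m) (L n)) = 0
  L_I : ∀ m n, g (L m) (I n) = 0
  I_L : ∀ m n, g (I m) (L n) = 0
  I_I : ∀ m n, g (I m) (I n) = 0

theorem WAlg.ConcentratedLL.ext {a b : ℂ} {g h : WAlg a b →ₗ[ℂ] WAlg a b →ₗ[ℂ] WAlg a b}
    (hg : ConcentratedLL g) (hh : ConcentratedLL h)
    (H : ∀ m n k, coordI (m + n + k) (g (L m) (L n)) = coordI (m + n + k) (h (L m) (L n))) :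
    g = h := by
  refine hom_ext (fun m n => ext_coord (fun k => ?_) (fun k => ?_)) (fun m n => ?_) (fun m n => ?_)
    (fun m n => ?_)
  · rw [hg.coordL_L_L, hh.coordL_L_L]
  · have := H m n (k - (m + n))
    rwa [add_sub_cancel] at this
  · rw [hg.L_I, hh.L_I]
  · rw [hg.I_L, hh.I_L]
  · rw [hg.I_I, hh.I_I]

/-! ### Reduction modulo inner biderivations -/

namespace IsBiderivation

section General

variable {A : Type*} [LieRing A] [LieAlgebra ℂ A] {f g : A →ₗ[ℂ] A →ₗ[ℂ] A}

/-- Transfers identities between the two arguments, with no symmetry assumed on `f`. -/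
theorem flip (hf : IsBiderivation f) : IsBiderivation f.flip := by
  refine ⟨fun x y z => ?_, fun x y z => ?_⟩
  · simp only [LinearMap.flip_apply, hf.2]
    abel
  · simp only [LinearMap.flip_apply, hf.1]
    abel

theorem add (hf : IsBiderivation f) (hg : IsBiderivation g) : IsBiderivation (f + g) := by
  refine ⟨fun x y z => ?_, fun x y z => ?_⟩
  · simp only [LinearMap.add_apply, hf.1, hg.1, lie_add, add_lie]
    abel
  · simp only [LinearMap.add_apply, hf.2, hg.2, lie_add, add_lie]
    abel

theorem smul (c : ℂ) (hf : IsBiderivation f) : IsBiderivation (c • f) := by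
  refine ⟨fun x y z => ?_, fun x y z => ?_⟩
  · simp only [LinearMap.smul_apply, hf.1, lie_smul, smul_lie, smul_add]
  · simp only [LinearMap.smul_apply, hf.2, lie_smul, smul_lie, smul_add]

theorem zero : IsBiderivation (0 : A →ₗ[ℂ] A →ₗ[ℂ] A) := by
  constructor <;> simp

theorem sum {ι : Type*} (s : Finset ι) {F : ι → A →ₗ[ℂ] A →ₗ[ℂ] A}
    (hF : ∀ i ∈ s, IsBiderivation (F i)) : IsBiderivation (∑ i ∈ s, F i) :=
  Finset.sum_induction F IsBiderivation (fun _ _ => add) zero hF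

end General

section WAlg

open WAlg

variable {a b : ℂ} {f : WAlg a b →ₗ[ℂ] WAlg a b →ₗ[ℂ] WAlg a b}

theorem lieBracket : IsBiderivation (bilin (gen a b)) := by
  refine ⟨fun x y z => ?_, fun x y z => ?_⟩
  · simp only [← lie_def]
    rw [lie_lie, sub_eq_add_neg, lie_skew]
  · simp only [← lie_def]
    rw [leibniz_lie]

theorem coordL_left (hf : IsBiderivation f) (m n r : ℤ) (z : WAlg a b) :
    ((m : ℂ) - n) * coordL (m + n + r) (f (L (m + n)) z) =
      ((m : ℂ) - n - r) * coordL (n + r) (f (L n) z) -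
        ((n : ℂ) - m - r) * coordL (m + r) (f (L m) z) := by
  have h := congrArg (coordL (m + n + r)) (hf.1 (L m) (L n) z)
  rw [← lie_skew (f (L m) z), lie_L_L, map_smul, LinearMap.smul_apply, map_smul, map_add, map_neg,
    show m + n + r = m + (n + r) by ring, coordL_lie_L, show m + (n + r) = n + (m + r) by ring,
    coordL_lie_L] at h
  rw [show m + n + r = n + (m + r) by ring]
  push_cast at h
  simp only [smul_eq_mul] at h
  linear_combination h

theorem coordI_left (hf : IsBiderivation f) (m n r : ℤ) (z : WAlg a b) :
    ((m : ℂ) - n) * coordI (m + n + r) (f (L (m + n)) z) =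
      -((n : ℂ) + r + a + b * m) * coordI (n + r) (f (L n) z) +
        ((m : ℂ) + r + a + b * n) * coordI (m + r) (f (L m) z) := by
  have h := congrArg (coordI (m + n + r)) (hf.1 (L m) (L n) z)
  rw [← lie_skew (f (L m) z), lie_L_L, map_smul, LinearMap.smul_apply, map_smul, map_add, map_neg,
    show m + n + r = m + (n + r) by ring, coordI_lie_L, show m + (n + r) = n + (m + r) by ring,
    coordI_lie_L] at h
  rw [show m + n + r = n + (m + r) by ring]
  push_cast at h
  simp only [smul_eq_mul] at h
  linear_combination h

theorem coordL_right_I (hf : IsBiderivation f) (m n k : ℤ) (x : WAlg a b) :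
    -((n : ℂ) + a + b * m) * coordL (m + k) (f x (I (m + n))) =
      ((m : ℂ) - k) * coordL k (f x (I n)) := by
  have h := congrArg (coordL (m + k)) (hf.2 x (L m) (I n))
  rw [← lie_skew (f x (L m)), lie_L_I, map_smul, map_smul, map_add, map_neg, coordL_lie_I,
    coordL_lie_L] at h
  simpa using h

/-- The term `⁅f x (L m), I n⁆` sees only the `L`-coordinates of `f x (L m)`, so `hx` removes it. -/
theorem coordI_right_I (hf : IsBiderivation f) (m n k : ℤ) (x : WAlg a b)
    (hx : ∀ j, coordL j (f x (L m)) = 0) :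
    -((n : ℂ) + a + b * m) * coordI (m + k) (f x (I (m + n))) =
      -((k : ℂ) + a + b * m) * coordI k (f x (I n)) := by
  have h := congrArg (coordI (m + k)) (hf.2 x (L m) (I n))
  rw [← lie_skew (f x (L m)), lie_L_I, map_smul, map_smul, map_add, map_neg, coordI_lie_L,
    show m + k = n + (m + k - n) by ring, coordI_lie_I, hx] at h
  simpa using h

theorem coordL_I_I (hf : IsBiderivation f) (m n j : ℤ) (x : WAlg a b) :
    ((n : ℂ) + a + b * j) * coordL j (f x (I m)) =
      ((m : ℂ) + a + b * (j + n - m)) * coordL (j + n - m) (f x (I n)) := by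
  have h := congrArg (coordI (n + j)) (hf.2 x (I m) (I n))
  rw [← lie_skew (f x (I m)), lie_I_I, map_zero, map_zero, map_add, map_neg, coordI_lie_I,
    show n + j = m + (j + n - m) by ring, coordI_lie_I] at h
  push_cast at h
  linear_combination h

/-- Modulo the ideal of the `I_k` this is the case `b = -1` with integral shift `r`: only `r = 0`
survives, and there the solution is the Witt bracket. -/
theorem coordL_L_L (hf : IsBiderivation f) :
    ∃ c : ℂ, ∀ m n k, coordL k (f (L m) (L n)) =
      c * coordL k ⁅(L m : WAlg a b), (L n : WAlg a b)⁆ := by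
  have hB : ∀ r : ℤ, BiderCoeff (-1) r (fun m n => coordL (m + n + r) (f (L m) (L n))) := fun r =>
    { left := fun m n p => by
        have h := hf.coordL_left m n (p + r) (L p)
        simp only [← add_assoc] at h
        push_cast at h
        linear_combination h
      right := fun m n p => by
        have h := hf.flip.coordL_left m n (p + r) (L p)
        simp only [← add_assoc, LinearMap.flip_apply] at h
        rw [add_comm p (m + n), add_comm p n, add_comm p m]
        push_cast at h
        linear_combination h }
  refine ⟨coordL (1 + 0 + 0) (f (L 1) (L 0)), fun m n k => ?_⟩
  obtain ⟨r, rfl⟩ : ∃ r, k = m + n + r := ⟨k - (m + n), by ring⟩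
  rw [lie_L_L, map_smul, coordL_L, smul_eq_mul]
  by_cases hr : r = 0
  · subst hr
    have h0 := hB 0
    rw [Int.cast_zero] at h0
    rw [h0.eq_of_b_neg_one m n]
    simp [mul_comm]
  · rw [if_neg (by lia), mul_zero, mul_zero]
    exact (hB r).eq_zero (by norm_num) (by norm_num) (fun _ => by exact_mod_cast hr) m n

/-- Comparing `L_0`-eigenvalues forces `m = n + a - r`. For fixed `n` and `r` this is at most one
point, which the derivation identity in the first argument excludes. -/
theorem coordL_L_I (hf : IsBiderivation f) (m n k : ℤ) : coordL k (f (L m) (I n)) = 0 := by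
  obtain ⟨r, rfl⟩ : ∃ r, k = m + r := ⟨k - m, by ring⟩
  by_cases h : ∃ q : ℤ, (q : ℂ) = n + a - r
  · obtain ⟨q, hq⟩ := h
    refine eq_zero_of_support_singleton (g := fun i => coordL (i + r) (f (L i) (I n)))
      (α := fun i j => (i : ℂ) - j - r) (β := fun i j => -((j : ℂ) - i - r))
      (fun i j => ?_) (q := q) (fun i hi => ?_) m
    · linear_combination hf.coordL_left i j r (I n)
    · have h := hf.coordL_right_I 0 n (i + r) (L i)
      rw [zero_add, zero_add] at h
      push_cast at h
      have h' : ((i : ℂ) - q) * coordL (i + r) (f (L i) (I n)) = 0 := by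
        linear_combination h - coordL (i + r) (f (L i) (I n)) * hq
      exact (mul_eq_zero.mp h').resolve_left (sub_ne_zero.mpr (by exact_mod_cast hi))
  · have h1 := hf.coordL_right_I 0 n (m + r) (L m)
    rw [zero_add, zero_add] at h1
    push_cast at h1
    have h' : ((m : ℂ) - (n + a - r)) * coordL (m + r) (f (L m) (I n)) = 0 := by
      linear_combination h1
    exact (mul_eq_zero.mp h').resolve_left (sub_ne_zero.mpr fun e => h ⟨m, e⟩)

theorem coordL_I_I_eq_zero (hf : IsBiderivation f) (m n k : ℤ) :
    coordL k (f (I m) (I n)) = 0 := by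
  have hr : ∀ {g : WAlg a b →ₗ[ℂ] WAlg a b →ₗ[ℂ] WAlg a b}, IsBiderivation g → ∀ m n k : ℤ,
      coordL k (g (I m) (I n)) ≠ 0 → (k : ℂ) = n + a := fun hg m n k hne => by
    have h := hg.coordL_right_I 0 n k (I m)
    rw [zero_add, zero_add] at h
    push_cast at h
    refine mul_right_cancel₀ hne ?_
    linear_combination h
  have hoff : ∀ m n k : ℤ, m ≠ n → coordL k (f (I m) (I n)) = 0 := fun m n k hmn => by
    by_contra hne
    have e : (m : ℂ) = n := by linear_combination hr hf m n k hne - hr hf.flip n m k hne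
    exact hmn (by exact_mod_cast e)
  by_cases hmn : m = n
  · subst hmn
    -- The diagonal value is annihilated by `m + 1 + a + b * k` and by `m + 2 + a + b * k`, which
    -- differ by 1.
    have h1 := hf.coordL_I_I m (m + 1) k (I m)
    have h2 := hf.coordL_I_I m (m + 2) k (I m)
    rw [hoff m (m + 1) _ (by lia)] at h1
    rw [hoff m (m + 2) _ (by lia)] at h2
    push_cast at h1 h2
    linear_combination h2 - h1
  · exact hoff m n k hmn

theorem coordI_L_I (hf : IsBiderivation f) (h0 : ∀ m n k, coordL k (f (L m) (L n)) = 0)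
    (m n k : ℤ) : coordI k (f (L m) (I n)) = 0 := by
  obtain ⟨r, rfl⟩ : ∃ r, k = m + r := ⟨k - m, by ring⟩
  refine eq_zero_of_support_singleton (g := fun i => coordI (i + r) (f (L i) (I n)))
    (α := fun i j => -((j : ℂ) + r + a + b * i)) (β := fun i j => (i : ℂ) + r + a + b * j)
    (fun i j => hf.coordI_left i j r (I n)) (q := n - r) (fun i hi => ?_) m
  have h := hf.coordI_right_I 0 n (i + r) (L i) (h0 i 0)
  rw [zero_add, zero_add] at h
  push_cast at h
  have h' : ((i : ℂ) - (n - r)) * coordI (i + r) (f (L i) (I n)) = 0 := by linear_combination h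
  exact (mul_eq_zero.mp h').resolve_left (sub_ne_zero.mpr (by exact_mod_cast hi))

theorem coordI_I_I (hf : IsBiderivation f) (m n k : ℤ) : coordI k (f (I m) (I n)) = 0 := by
  have hr : ∀ {g : WAlg a b →ₗ[ℂ] WAlg a b →ₗ[ℂ] WAlg a b}, IsBiderivation g → ∀ m n k : ℤ,
      coordI k (g (I m) (I n)) ≠ 0 → k = n := fun hg m n k hne => by
    have h := hg.coordI_right_I 0 n k (I m) (hg.flip.coordL_L_I 0 m)
    rw [zero_add, zero_add] at h
    push_cast at h
    have e : (k : ℂ) = n := by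
      refine mul_right_cancel₀ hne ?_
      linear_combination h
    exact_mod_cast e
  have hoff : ∀ m n k : ℤ, m ≠ n → coordI k (f (I m) (I n)) = 0 := fun m n k hmn => by
    by_contra hne
    exact hmn ((hr hf.flip n m k hne).symm.trans (hr hf m n k hne))
  by_cases hmn : m = n
  · subst hmn
    by_cases hk : k = m
    · subst hk
      have hx : ∀ i j, coordL j (f (I k) (L i : WAlg a b)) = 0 := fun i => hf.flip.coordL_L_I i k
      have h1 := hf.coordI_right_I 1 k k (I k) (hx 1)
      have h2 := hf.coordI_right_I 2 k k (I k) (hx 2)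
      have h3 := hf.coordI_right_I (-1) (k + 1) (k + 1) (I k) (hx (-1))
      rw [hoff k _ _ (by lia)] at h1 h2
      rw [hoff k (k + 1) _ (by lia), show -1 + (k + 1) = k by ring] at h3
      push_cast at h1 h2 h3
      -- The diagonal value is annihilated by `k + a + b`, `k + a + 2b` and `k + 1 + a - b`; with
      -- weights -3, 2, 1 these add up to 1.
      linear_combination (-3 : ℂ) * h1 + 2 * h2 - h3
    · by_contra hne
      exact hk (hr hf m m k hne)
  · exact hoff m n k hmn

theorem coeff (hf : IsBiderivation f) (k : ℤ) :
    BiderCoeff b (k + a) (fun m n => coordI (m + n + k) (f (L m) (L n))) where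
  left m n p := by
    have h := hf.coordI_left m n (p + k) (L p)
    simp only [← add_assoc] at h
    push_cast at h
    linear_combination h
  right m n p := by
    have h := hf.flip.coordI_left m n (p + k) (L p)
    simp only [← add_assoc, LinearMap.flip_apply] at h
    rw [add_comm p (m + n), add_comm p n, add_comm p m]
    push_cast at h
    linear_combination h

/-- Modulo inner biderivations, a biderivation is determined by the `I`-coordinates of its values
at the pairs `(L_m, L_n)`. -/
theorem exists_eq_lie_add (hf : IsBiderivation f) :
    ∃ (c : ℂ) (g : WAlg a b →ₗ[ℂ] WAlg a b →ₗ[ℂ] WAlg a b), IsBiderivation g ∧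
      (∀ x y, f x y = c • ⁅x, y⁆ + g x y) ∧ ConcentratedLL g := by
  obtain ⟨c, hc⟩ := hf.coordL_L_L
  have hg : IsBiderivation (f + (-c) • bilin (gen a b)) := hf.add (lieBracket.smul (-c))
  have hL : ∀ m n k, coordL k ((f + (-c) • bilin (gen a b)) (L m) (L n)) = 0 := fun m n k => by
    simp [hc, ← lie_def]
  refine ⟨c, _, hg, fun x y => ?_, hL, fun m n => ?_, fun m n => ?_,
    fun m n => ?_⟩
  · simp [← lie_def]
  · exact ext_coord (fun k => by rw [hg.coordL_L_I, map_zero])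
      (fun k => by rw [hg.coordI_L_I hL, map_zero])
  · exact ext_coord (fun k => (hg.flip.coordL_L_I n m k).trans (map_zero _).symm)
      (fun k => (hg.flip.coordI_L_I (fun i j => hL j i) n m k).trans (map_zero _).symm)
  · exact ext_coord (fun k => by rw [hg.coordL_I_I_eq_zero, map_zero])
      (fun k => by rw [hg.coordI_I_I, map_zero])

end WAlg

end IsBiderivation

/-! ### Constructing biderivations from coefficient solutions -/

namespace WAlg

variable {a b : ℂ}

/-- The bilinear map with `(L_m, L_n) ↦ B m n • I_{m+n+k}` which vanishes on the other pairs of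
basis vectors. -/
noncomputable def homogeneous (a b : ℂ) (B : ℤ → ℤ → ℂ) (k : ℤ) :
    WAlg a b →ₗ[ℂ] WAlg a b →ₗ[ℂ] WAlg a b :=
  bilin fun
    | Sum.inl m, Sum.inl n => B m n • I (m + n + k)
    | _, _ => 0

/-- Only triples `(L, L, L)` impose a condition, namely `hB.left`; otherwise every term vanishes
because the values lie in an abelian ideal that the map annihilates. -/
theorem homogeneous_left {B : ℤ → ℤ → ℂ} {k : ℤ} (hB : BiderCoeff b (k + a) B)
    (x y z : WAlg a b) : homogeneous a b B k ⁅x, y⁆ z =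
      ⁅x, homogeneous a b B k y z⁆ + ⁅homogeneous a b B k x z, y⁆ := by
  induction x using WAlg.induction with
  | h0 => simp
  | hadd x x' h h' => simp only [map_add, LinearMap.add_apply, add_lie, h, h']; abel
  | hL c m =>
    induction y using WAlg.induction with
    | h0 => simp
    | hadd x x' h h' => simp only [map_add, LinearMap.add_apply, lie_add, h, h']; abel
    | hL d n =>
      induction z using WAlg.induction with
      | h0 => simp
      | hadd x x' h h' => simp only [map_add, lie_add, add_lie, h, h']; abel
      | hL e p =>
        simp only [map_smul, LinearMap.smul_apply, smul_lie, lie_smul, homogeneous, lie_L_L,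
          bilin_L_L, lie_L_I, lie_I_L, show m + (n + p + k) = m + n + p + k by ring,
          show m + p + k + n = m + n + p + k by ring]
        have h := hB.left m n p
        simp only [smul_smul, ← add_smul]
        congr 1
        push_cast
        linear_combination c * d * e * h
      | hI e p => simp [homogeneous, lie_L_L, bilin_L_I]
    | hI d n =>
      induction z using WAlg.induction with
      | h0 => simp
      | hadd x x' h h' => simp only [map_add, lie_add, add_lie, h, h']; abel
      | hL e p => simp [homogeneous, lie_L_I, lie_I_I, bilin_L_L, bilin_I_L]
      | hI e p => simp [homogeneous, lie_L_I, bilin_L_I, bilin_I_I]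
  | hI c m =>
    induction y using WAlg.induction with
    | h0 => simp
    | hadd x x' h h' => simp only [map_add, LinearMap.add_apply, lie_add, h, h']; abel
    | hL d n =>
      induction z using WAlg.induction with
      | h0 => simp
      | hadd x x' h h' => simp only [map_add, lie_add, add_lie, h, h']; abel
      | hL e p => simp [homogeneous, lie_I_L, lie_I_I, bilin_L_L, bilin_I_L]
      | hI e p => simp [homogeneous, lie_I_L, bilin_L_I, bilin_I_I]
    | hI d n =>
      induction z using WAlg.induction with
      | h0 => simp
      | hadd x x' h h' => simp only [map_add, lie_add, add_lie, h, h']; abel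
      | hL e p => simp [homogeneous, lie_I_I, bilin_I_L]
      | hI e p => simp [homogeneous, lie_I_I, bilin_I_I]

theorem homogeneous_flip (B : ℤ → ℤ → ℂ) (k : ℤ) :
    (homogeneous a b B k).flip = homogeneous a b (fun m n => B n m) k := by
  refine hom_ext (fun m n => ?_) (fun m n => ?_) (fun m n => ?_) (fun m n => ?_) <;>
    simp [homogeneous, bilin_L_L, bilin_L_I, bilin_I_L, bilin_I_I, add_comm]

theorem isBiderivation_homogeneous {B : ℤ → ℤ → ℂ} {k : ℤ} (hB : BiderCoeff b (k + a) B) :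
    IsBiderivation (homogeneous a b B k) := by
  refine ⟨homogeneous_left hB, fun x y z => ?_⟩
  -- Transposing the coefficients exchanges the two recursions.
  have h := homogeneous_left (B := fun m n => B n m) ⟨hB.right, hB.left⟩ y z x
  rw [← homogeneous_flip] at h
  simp only [LinearMap.flip_apply] at h
  rw [h, add_comm]

theorem Psi_eq_sum (a : ℂ) (Ω : ℤ →₀ ℂ) :
    Psi a Ω = ∑ k ∈ Ω.support, homogeneous a 0 (fun _ _ => Ω k) k := by
  refine hom_ext (fun m n => ?_) (fun m n => ?_) (fun m n => ?_) (fun m n => ?_) <;>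
    simp [homogeneous, Psi, bilin_L_L, bilin_L_I, bilin_I_L, bilin_I_I, Finsupp.sum]

theorem Upsilon_eq_sum (a : ℂ) (Ω : ℤ →₀ ℂ) :
    Upsilon a Ω =
      ∑ k ∈ Ω.support, homogeneous a 1 (fun m n => ((m : ℂ) + n + (k + a)) * Ω k) k := by
  refine hom_ext (fun m n => ?_) (fun m n => ?_) (fun m n => ?_) (fun m n => ?_) <;>
    simp [homogeneous, Upsilon, bilin_L_L, bilin_L_I, bilin_I_L, bilin_I_I, Finsupp.sum, add_assoc]

theorem Theta_eq (a : ℤ) (μ : ℂ) :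
    Theta a μ = homogeneous (a : ℂ) (-1) (fun m n => ((m : ℂ) - n) * μ) (-a) := by
  refine hom_ext (fun m n => ?_) (fun m n => ?_) (fun m n => ?_) (fun m n => ?_) <;>
    simp [homogeneous, Theta, bilin_L_L, bilin_L_I, bilin_I_L, bilin_I_I, sub_eq_add_neg]

theorem isBiderivation_Psi (a : ℂ) (Ω : ℤ →₀ ℂ) : IsBiderivation (Psi a Ω) := by
  rw [Psi_eq_sum]
  exact IsBiderivation.sum _ fun k _ => isBiderivation_homogeneous (.const _ _)

theorem isBiderivation_Upsilon (a : ℂ) (Ω : ℤ →₀ ℂ) : IsBiderivation (Upsilon a Ω) := by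
  rw [Upsilon_eq_sum]
  exact IsBiderivation.sum _ fun k _ => isBiderivation_homogeneous (.add_mul_const _ _)

theorem isBiderivation_Theta (a : ℤ) (μ : ℂ) : IsBiderivation (Theta a μ) := by
  rw [Theta_eq]
  refine isBiderivation_homogeneous ?_
  rw [Int.cast_neg, neg_add_cancel]
  exact .sub_mul_const _

theorem coordI_Psi (a : ℂ) (Ω : ℤ →₀ ℂ) (m n k : ℤ) :
    coordI (m + n + k) (Psi a Ω (L m) (L n)) = Ω k := by
  simp +contextual [Psi, bilin_L_L, Finsupp.sum, coordI_I, eq_comm]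

theorem coordI_Upsilon (a : ℂ) (Ω : ℤ →₀ ℂ) (m n k : ℤ) :
    coordI (m + n + k) (Upsilon a Ω (L m) (L n)) = ((m : ℂ) + n + k + a) * Ω k := by
  simp +contextual [Upsilon, bilin_L_L, Finsupp.sum, coordI_I]

theorem coordI_Theta (a : ℤ) (μ : ℂ) (m n k : ℤ) :
    coordI (m + n + k) (Theta a μ (L m) (L n)) = if k = -a then ((m : ℂ) - n) * μ else 0 := by
  simp only [Theta, bilin_L_L, map_smul, coordI_I, smul_eq_mul, mul_ite, mul_one, mul_zero]
  exact if_congr (by lia) rfl rfl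

end WAlg

/-! ### The classification -/

namespace WAlg

variable {a b : ℂ}

theorem concentratedLL_zero : ConcentratedLL (0 : WAlg a b →ₗ[ℂ] WAlg a b →ₗ[ℂ] WAlg a b) where
  coordL_L_L _ _ _ := by simp
  L_I _ _ := rfl
  I_L _ _ := rfl
  I_I _ _ := rfl

theorem concentratedLL_Psi (a : ℂ) (Ω : ℤ →₀ ℂ) : ConcentratedLL (Psi a Ω) where
  coordL_L_L _ _ _ := by simp [Psi, bilin_L_L, Finsupp.sum, coordL_I]
  L_I _ _ := bilin_L_I _ _ _
  I_L _ _ := bilin_I_L _ _ _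
  I_I _ _ := bilin_I_I _ _ _

theorem concentratedLL_Upsilon (a : ℂ) (Ω : ℤ →₀ ℂ) : ConcentratedLL (Upsilon a Ω) where
  coordL_L_L _ _ _ := by simp [Upsilon, bilin_L_L, Finsupp.sum, coordL_I]
  L_I _ _ := bilin_L_I _ _ _
  I_L _ _ := bilin_I_L _ _ _
  I_I _ _ := bilin_I_I _ _ _

theorem concentratedLL_Theta (a : ℤ) (μ : ℂ) : ConcentratedLL (Theta a μ) where
  coordL_L_L _ _ _ := by simp [Theta, bilin_L_L, coordL_I]
  L_I _ _ := bilin_L_I _ _ _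
  I_L _ _ := bilin_I_L _ _ _
  I_I _ _ := bilin_I_I _ _ _

/-- The sequence of `I`-coordinates of a vector. -/
noncomputable def coordsI (x : WAlg a b) : ℤ →₀ ℂ :=
  Finsupp.comapDomain Sum.inr (x : (ℤ ⊕ ℤ) →₀ ℂ) Sum.inr_injective.injOn

theorem coordsI_apply (x : WAlg a b) (k : ℤ) : coordsI x k = coordI k x := rfl

theorem isBiderivation_of_forall_eq {f g : WAlg a b →ₗ[ℂ] WAlg a b →ₗ[ℂ] WAlg a b} {c : ℂ}
    (hg : IsBiderivation g) (h : ∀ x y, f x y = c • ⁅x, y⁆ + g x y) : IsBiderivation f := by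
  have : f = c • bilin (gen a b) + g := LinearMap.ext₂ fun x y => by simp [h, lie_def]
  rw [this]
  exact (IsBiderivation.lieBracket.smul c).add hg

theorem isBiderivation_iff_Psi (a : ℂ) (f : WAlg a 0 →ₗ[ℂ] WAlg a 0 →ₗ[ℂ] WAlg a 0) :
    IsBiderivation f ↔
      ∃ (c : ℂ) (Ω : ℤ →₀ ℂ), ∀ x y : WAlg a 0, f x y = c • ⁅x, y⁆ + Psi a Ω x y := by
  refine ⟨fun hf => ?_, fun ⟨c, Ω, h⟩ => isBiderivation_of_forall_eq (isBiderivation_Psi a Ω) h⟩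
  obtain ⟨c, g, hg, hfg, hc⟩ := hf.exists_eq_lie_add
  -- Reading all the constants off one vector makes the sequence finitely supported.
  refine ⟨c, coordsI (g (L 0) (L 0)), ?_⟩
  rwa [← hc.ext (concentratedLL_Psi _ _) fun m n k => ?_]
  rw [coordI_Psi, coordsI_apply]
  simpa using (hg.coeff k).eq_of_b_zero m n

theorem isBiderivation_iff_Upsilon (a : ℂ) (f : WAlg a 1 →ₗ[ℂ] WAlg a 1 →ₗ[ℂ] WAlg a 1) :
    IsBiderivation f ↔
      ∃ (c : ℂ) (Ω : ℤ →₀ ℂ), ∀ x y : WAlg a 1, f x y = c • ⁅x, y⁆ + Upsilon a Ω x y := by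
  refine ⟨fun hf => ?_,
    fun ⟨c, Ω, h⟩ => isBiderivation_of_forall_eq (isBiderivation_Upsilon a Ω) h⟩
  obtain ⟨c, g, hg, hfg, hc⟩ := hf.exists_eq_lie_add
  -- The coordinate of `g (L 0) (L 1)` for shift `k` sits at `1 + k`, hence the reindexing before
  -- taking the increment.
  refine ⟨c, Finsupp.comapDomain (fun k => 1 + k) (coordsI (g (L 0) (L 1)))
    (add_right_injective 1).injOn - coordsI (g (L 0) (L 0)), ?_⟩
  rwa [← hc.ext (concentratedLL_Upsilon _ _) fun m n k => ?_]
  rw [coordI_Upsilon, Finsupp.sub_apply, Finsupp.comapDomain_apply, coordsI_apply, coordsI_apply]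
  have h := (hg.coeff k).eq_of_b_one m n
  simp only [zero_add] at h
  rw [h]
  ring

theorem isBiderivation_iff_Theta (a : ℤ)
    (f : WAlg (a : ℂ) (-1) →ₗ[ℂ] WAlg (a : ℂ) (-1) →ₗ[ℂ] WAlg (a : ℂ) (-1)) :
    IsBiderivation f ↔
      ∃ c μ : ℂ, ∀ x y : WAlg (a : ℂ) (-1), f x y = c • ⁅x, y⁆ + Theta a μ x y := by
  refine ⟨fun hf => ?_, fun ⟨c, μ, h⟩ => isBiderivation_of_forall_eq (isBiderivation_Theta a μ) h⟩
  obtain ⟨c, g, hg, hfg, hc⟩ := hf.exists_eq_lie_add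
  refine ⟨c, coordI (1 + 0 + -a) (g (L 1) (L 0)), ?_⟩
  rwa [← hc.ext (concentratedLL_Theta _ _) fun m n k => ?_]
  rw [coordI_Theta]
  have h := hg.coeff k
  by_cases hk : k = -a
  · subst hk
    rw [if_pos rfl]
    rw [Int.cast_neg, neg_add_cancel] at h
    exact h.eq_of_b_neg_one m n
  · rw [if_neg hk]
    refine h.eq_zero (by norm_num) (by norm_num) (fun _ e => hk ?_) m n
    have e' : (k : ℂ) = ((-a : ℤ) : ℂ) := by push_cast; linear_combination e
    exact_mod_cast e'

theorem isBiderivation_iff_isInner (h0 : b ≠ 0) (h1 : b ≠ 1)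
    (hab : ¬ ((∃ k : ℤ, a = (k : ℂ)) ∧ b = -1)) (f : WAlg a b →ₗ[ℂ] WAlg a b →ₗ[ℂ] WAlg a b) :
    IsBiderivation f ↔ IsInnerBiderivation f := by
  refine ⟨fun hf => ?_, fun ⟨c, h⟩ =>
    isBiderivation_of_forall_eq (c := c) .zero fun x y => by simp [h]⟩
  obtain ⟨c, g, hg, hfg, hc⟩ := hf.exists_eq_lie_add
  refine ⟨c, fun x y => ?_⟩
  rw [hfg, hc.ext concentratedLL_zero fun m n k => ?_]
  · simp
  · refine ((hg.coeff k).eq_zero h0 h1 (fun hb e => hab ⟨⟨-k, ?_⟩, hb⟩) m n).trans (by simp)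
    push_cast
    linear_combination e

/-! ### Symmetric and skew biderivations -/

theorem Psi_symm (a : ℂ) (Ω : ℤ →₀ ℂ) (x y : WAlg a 0) : Psi a Ω x y = Psi a Ω y x := by
  have h : Psi a Ω = (Psi a Ω).flip := by
    refine hom_ext (fun m n => ?_) (fun m n => ?_) (fun m n => ?_) (fun m n => ?_) <;>
      simp [Psi, bilin_L_L, bilin_L_I, bilin_I_L, bilin_I_I, add_comm]
  exact LinearMap.congr_fun₂ h x y

theorem Upsilon_symm (a : ℂ) (Ω : ℤ →₀ ℂ) (x y : WAlg a 1) :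
    Upsilon a Ω x y = Upsilon a Ω y x := by
  have h : Upsilon a Ω = (Upsilon a Ω).flip := by
    refine hom_ext (fun m n => ?_) (fun m n => ?_) (fun m n => ?_) (fun m n => ?_) <;>
      simp [Upsilon, bilin_L_L, bilin_L_I, bilin_I_L, bilin_I_I, add_comm, add_left_comm]
  exact LinearMap.congr_fun₂ h x y

theorem Theta_skew (a : ℤ) (μ : ℂ) (x y : WAlg (a : ℂ) (-1)) :
    Theta a μ x y = -Theta a μ y x := by
  have h : Theta a μ = -(Theta a μ).flip := by
    refine hom_ext (fun m n => ?_) (fun m n => ?_) (fun m n => ?_) (fun m n => ?_) <;>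
      simp [Theta, bilin_L_L, bilin_L_I, bilin_I_L, bilin_I_I, add_comm, ← neg_smul, ← neg_mul]
  exact LinearMap.congr_fun₂ h x y

theorem not_isInner_of_ne_zero {f : WAlg a b →ₗ[ℂ] WAlg a b →ₗ[ℂ] WAlg a b} {x : WAlg a b}
    (h : f x x ≠ 0) : ¬ IsInnerBiderivation f := fun ⟨c, hc⟩ => h (by rw [hc, lie_self, smul_zero])

theorem exists_symm_not_isInner_of_b_zero (a : ℂ) : ∃ f : WAlg a 0 →ₗ[ℂ] WAlg a 0 →ₗ[ℂ] WAlg a 0,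
    IsBiderivation f ∧ (∀ x y : WAlg a 0, f x y = f y x) ∧ ¬ IsInnerBiderivation f := by
  refine ⟨_, isBiderivation_Psi a (Finsupp.single 0 1), Psi_symm a _,
    not_isInner_of_ne_zero (x := L 0) fun h => ?_⟩
  have := congrArg (coordI (0 + 0 + 0)) h
  rw [coordI_Psi] at this
  simp at this

theorem exists_symm_not_isInner_of_b_one (a : ℂ) : ∃ f : WAlg a 1 →ₗ[ℂ] WAlg a 1 →ₗ[ℂ] WAlg a 1,
    IsBiderivation f ∧ (∀ x y : WAlg a 1, f x y = f y x) ∧ ¬ IsInnerBiderivation f := by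
  -- The value of the chosen map at `(L_0, L_0)` is `(k + a) I_k`, which must not vanish.
  obtain ⟨k, hk⟩ : ∃ k : ℤ, (k : ℂ) + a ≠ 0 := by
    by_cases ha : a = 0
    · exact ⟨1, by simp [ha]⟩
    · exact ⟨0, by simpa using ha⟩
  refine ⟨_, isBiderivation_Upsilon a (Finsupp.single k 1), Upsilon_symm a _,
    not_isInner_of_ne_zero (x := L 0) fun h => hk ?_⟩
  have := congrArg (coordI (0 + 0 + k)) h
  rw [coordI_Upsilon] at this
  simpa using this

theorem isInner_of_symm_of_b_neg_one {a : ℤ}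
    {f : WAlg (a : ℂ) (-1) →ₗ[ℂ] WAlg (a : ℂ) (-1) →ₗ[ℂ] WAlg (a : ℂ) (-1)}
    (hf : IsBiderivation f) (hs : ∀ x y, f x y = f y x) : IsInnerBiderivation f := by
  obtain ⟨c, μ, h⟩ := (isBiderivation_iff_Theta a f).mp hf
  -- Every biderivation here is skew, so a symmetric one is zero.
  refine ⟨0, fun x y => ?_⟩
  have hskew : f x y = -f x y := by
    nth_rewrite 2 [hs]
    rw [h, h, Theta_skew a μ x y, ← lie_skew x y, smul_neg, neg_add]
  rw [zero_smul]
  have h2 : (2 : ℂ) • f x y = 0 := by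
    rw [two_smul]
    nth_rewrite 1 [hskew]
    exact neg_add_cancel _
  exact (smul_eq_zero.mp h2).resolve_left two_ne_zero

end WAlg

theorem theorem3p2 :
    (∀ (a : ℂ) (f : WAlg a 0 →ₗ[ℂ] WAlg a 0 →ₗ[ℂ] WAlg a 0),
      IsBiderivation f ↔
        ∃ (c : ℂ) (Ω : ℤ →₀ ℂ), ∀ x y : WAlg a 0, f x y = c • ⁅x, y⁆ + WAlg.Psi a Ω x y) ∧
    (∀ (a : ℂ) (f : WAlg a 1 →ₗ[ℂ] WAlg a 1 →ₗ[ℂ] WAlg a 1),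
      IsBiderivation f ↔
        ∃ (c : ℂ) (Ω : ℤ →₀ ℂ), ∀ x y : WAlg a 1, f x y = c • ⁅x, y⁆ + WAlg.Upsilon a Ω x y) ∧
    (∀ (a : ℤ) (f : WAlg (a : ℂ) (-1) →ₗ[ℂ] WAlg (a : ℂ) (-1) →ₗ[ℂ] WAlg (a : ℂ) (-1)),
      IsBiderivation f ↔
        ∃ c μ : ℂ, ∀ x y : WAlg (a : ℂ) (-1), f x y = c • ⁅x, y⁆ + WAlg.Theta a μ x y) ∧
    (∀ a b : ℂ, b ≠ 0 → b ≠ 1 → ¬ ((∃ k : ℤ, a = (k : ℂ)) ∧ b = -1) →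
      ∀ f : WAlg a b →ₗ[ℂ] WAlg a b →ₗ[ℂ] WAlg a b,
        IsBiderivation f ↔ IsInnerBiderivation f) ∧
    (∀ a b : ℂ,
      (∃ f : WAlg a b →ₗ[ℂ] WAlg a b →ₗ[ℂ] WAlg a b,
        IsBiderivation f ∧ (∀ x y : WAlg a b, f x y = f y x) ∧ ¬ IsInnerBiderivation f) ↔
      (b = 0 ∨ b = 1)) := by
  refine ⟨WAlg.isBiderivation_iff_Psi, WAlg.isBiderivation_iff_Upsilon,
    WAlg.isBiderivation_iff_Theta,
    fun a b h0 h1 hab f => WAlg.isBiderivation_iff_isInner h0 h1 hab f, fun a b => ⟨?_, ?_⟩⟩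
  · rintro ⟨f, hf, hs, hni⟩
    by_contra! hb
    by_cases hab : (∃ k : ℤ, a = (k : ℂ)) ∧ b = -1
    · obtain ⟨⟨k, rfl⟩, rfl⟩ := hab
      exact hni (WAlg.isInner_of_symm_of_b_neg_one hf hs)
    · exact hni ((WAlg.isBiderivation_iff_isInner hb.1 hb.2 hab f).mp hf)
  · rintro (rfl | rfl)
    · exact WAlg.exists_symm_not_isInner_of_b_zero a
    · exact WAlg.exists_symm_not_isInner_of_b_one a
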